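/- Let $S$ be a countable set and let $P=(P_{r,s})_{r,s\in S}$ be a stochastic matrix, where $P_{r,s}\in[0,1]$ is the probability of moving from $s$ to $r$ and $\sum_{r\in S}P_{r,s}=1$ for every $s$. Let $X_\bullet=(X_n)_{n\ge 1}$ be an $S$-valued Markov chain on a probability space, with transition matrix $P$ and arbitrary initial distribution, where $X_n$ is the state of the $n$-th job $J_n$ of a real-time task. Let $S_{\mathrm{DM}}\subseteq S$ be the set of states that indicate a deadline miss; that is, the variable $\mathrm{DM}(j)$, equal to $1$ if $J_j$ misses its deadline and to $0$ otherwise, is $1$ exactly when $X_j\in S_{\mathrm{DM}}$. Put $\mathrm{DMR}_N=\frac1N\sum_{j=1}^N\mathrm{DM}(j)$. A real number $\mathrm{DMR}$ is called the deadline miss rate if $\mathbb P(\lim_{N\to\infty}\mathrm{DMR}_N=\mathrm{DMR})=1$. Suppose that $X_\bullet$ is irreducible (every state can be reached from every state along transitions of positive probability) and positive recurrent (for every $s\in S$, the chain with transition matrix $P$ started at $X_1=s$ satisfies $\mathbb E[T_s\mid X_1=s]<\infty$, where $T_s=\inf\{n\ge 2 : X_n=s\}$ and $\inf\emptyset=\infty$).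 Then there is a unique invariant distribution $\pi$, i.e. a unique $\pi=(\pi_s)_{s\in S}$ with $\pi_s\ge 0$, $\sum_{s\in S}\pi_s=1$ and $P\pi=\pi$, and $$\mathbb P\Big(\lim_{N\to\infty}\mathrm{DMR}_N=\sum_{s\in S_{\mathrm{DM}}}\pi_s\Big)=1 .$$ Therefore the deadline miss rate exists and is $\mathrm{DMR}=\sum_{s\in S_{\mathrm{DM}}}\pi_s$. -/

import Mathlib

open MeasureTheory Filter Topology
open scoped ENNReal

namespace DeadlineMiss

/-- A (left, i.e. column-) stochastic matrix on a state space `S`: `P r s` is the probability of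
moving from state `s` to state `r`, and each column sums to `1`. -/
structure StochasticMatrix (S : Type*) where
  /-- the entries -/
  entry : Matrix S S ℝ
  nonneg : ∀ r s, 0 ≤ entry r s
  hasSum_col : ∀ s, HasSum (fun r => entry r s) 1

section Chain

variable {S : Type*}

/-- The `s`-th column of a stochastic matrix, as a probability distribution on `S`:
the law of the next state when the current state is `s`. -/
noncomputable def StochasticMatrix.col (P : StochasticMatrix S) (s : S) : PMF S :=
  ⟨fun r => ENNReal.ofReal (P.entry r s), by
    have h := P.hasSum_col s
    have h2 := ENNReal.ofReal_tsum_of_nonneg (fun r => P.nonneg r s) h.summable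
    rw [h.tsum_eq, ENNReal.ofReal_one] at h2
    rw [h2]
    exact ENNReal.summable.hasSum⟩

/-- `X = (X_n)` is a Markov chain with transition matrix `P` under `μ`. Time is counted from `0`, so
`X 0` is the first state of the chain; its law, the initial distribution, is arbitrary. The
conditional probabilities are required to be the right ones whenever they are defined. -/
structure IsMarkovChain {Ω : Type*} [MeasurableSpace Ω] [MeasurableSpace S]
    (μ : Measure Ω) (X : ℕ → Ω → S) (P : StochasticMatrix S) : Prop where
  measurable : ∀ n, Measurable (X n)
  /-- the Markov property -/
  markov : ∀ (n : ℕ) (x : ℕ → S) (r : S), μ {ω | ∀ i ≤ n, X i ω = x i} ≠ 0 →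
    ProbabilityTheory.cond μ {ω | ∀ i ≤ n, X i ω = x i} {ω | X (n + 1) ω = r} =
      ProbabilityTheory.cond μ {ω | X n ω = x n} {ω | X (n + 1) ω = r}
  /-- the transition probabilities -/
  transition : ∀ (n : ℕ) (s r : S), μ {ω | X n ω = s} ≠ 0 →
    ProbabilityTheory.cond μ {ω | X n ω = s} {ω | X (n + 1) ω = r} =
      ENNReal.ofReal (P.entry r s)

/-- The chain is irreducible: any state can be reached from any state (itself included) along a
nonempty path of transitions of positive probability. -/
def StochasticMatrix.IsIrreducible (P : StochasticMatrix S) : Prop :=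
  ∀ r s : S, Relation.TransGen (fun a b => 0 < P.entry b a) r s

variable [MeasurableSpace S] [DiscreteMeasurableSpace S]

/-- One step of the chain, as a kernel. -/
noncomputable def StochasticMatrix.stepKernel (P : StochasticMatrix S) :
    ProbabilityTheory.Kernel S S where
  toFun s := (P.col s).toMeasure
  measurable' := Measurable.of_discrete

instance (P : StochasticMatrix S) : ProbabilityTheory.IsMarkovKernel P.stepKernel :=
  ⟨fun s => inferInstanceAs (IsProbabilityMeasure (P.col s).toMeasure)⟩

/-- The law of `X_{n+1}` given the history `X_0, …, X_n`. -/
noncomputable def StochasticMatrix.historyKernel (P : StochasticMatrix S) (n : ℕ) :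
    ProbabilityTheory.Kernel (Finset.Iic n → S) S :=
  P.stepKernel.comap (fun x => x ⟨n, Finset.mem_Iic.2 le_rfl⟩) (measurable_pi_apply _)

instance (P : StochasticMatrix S) (n : ℕ) :
    ProbabilityTheory.IsMarkovKernel (P.historyKernel n) :=
  inferInstanceAs (ProbabilityTheory.IsMarkovKernel (P.stepKernel.comap _ _))

/-- The law `ℙ( · | X_0 = s)` of the trajectory of the chain with transition matrix `P` started
at `s`, built by the Ionescu-Tulcea theorem. -/
noncomputable def StochasticMatrix.lawFrom (P : StochasticMatrix S) (s : S) :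
    Measure (ℕ → S) :=
  ProbabilityTheory.Kernel.traj (X := fun _ => S) P.historyKernel 0 (fun _ => s)

end Chain

/-- The first passage time of the state `s` along a trajectory, not counting the initial state;
`∞` if `s` is not visited again. The states `x 0, x 1, …` are numbered `1, 2, …`, so that the
possible finite values are `2, 3, …`. -/
noncomputable def firstPassage {S : Type*} (s : S) (x : ℕ → S) : ℝ≥0∞ :=
  ⨅ (n : ℕ) (_ : 1 ≤ n ∧ x n = s), ((n + 1 : ℕ) : ℝ≥0∞)

/-- The chain is positive recurrent: `𝔼[T_s | X_0 = s] < ∞` for each state `s`, with `T_s` the first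
passage time of `s`. -/
def StochasticMatrix.IsPositiveRecurrent {S : Type*} [MeasurableSpace S]
    [DiscreteMeasurableSpace S] (P : StochasticMatrix S) : Prop :=
  ∀ s : S, ∫⁻ x, firstPassage s x ∂(P.lawFrom s) < ∞

/-- `π` is a stationary (invariant) probability distribution of `P`, i.e. `P π = π`. -/
structure StochasticMatrix.IsStationary {S : Type*} (P : StochasticMatrix S) (π : S → ℝ) :
    Prop where
  nonneg : ∀ s, 0 ≤ π s
  hasSum_one : HasSum π 1
  invariant : ∀ r, HasSum (fun s => P.entry r s * π s) (π r)

section Rate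

variable {Ω : Type*}

/-- The 0-1-valued variable `DM`, where `missed j` is the event that job number `j` (counted
from `0`) misses its deadline. -/
noncomputable def DM (missed : ℕ → Set Ω) (j : ℕ) : Ω → ℝ := (missed j).indicator 1

/-- The deadline miss rate of the first `N` jobs. -/
noncomputable def DMRUpTo (missed : ℕ → Set Ω) (N : ℕ) (ω : Ω) : ℝ :=
  (1 / (N : ℝ)) * ∑ j ∈ Finset.range N, DM missed j ω

/-- The number `d` is the deadline miss rate: the miss rates of the first `N` jobs converge to `d`
almost surely. -/
def IsDeadlineMissRate [MeasurableSpace Ω] (μ : Measure Ω) (missed : ℕ → Set Ω) (d : ℝ) :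
    Prop :=
  ∀ᵐ ω ∂μ, Tendsto (fun N : ℕ => DMRUpTo missed N ω) atTop (𝓝 d)

end Rate

end DeadlineMiss

namespace DeadlineMiss

/-! The proof is regenerative. Start the chain at `s` and cut the trajectory at its successive
returns to `s`. By the Markov property each excursion is independent of what follows it, and the
path after a return has the original law (`lawFrom_inter_afterReturn`). Positive recurrence makes
returns almost sure and excursion lengths integrable, so the strong law applies both to the lengths
and to the numbers of visits to `A`. Their quotient is the asymptotic frequency of `A`, namely mean
visits per excursion over mean excursion length: `excursionFreq s A`.

Having a given frequency is a shift-invariant property and every state is reached from `s` with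
positive probability, so the same limit holds from every initial state (`tendsto_average`). It
passes to the given chain, whose law is a mixture of the `lawFrom s`.

Taking expectations, the time averages of the occupation probabilities converge to `excursionFreq s
{r}`, whatever the initial state. The forward equation gives `P π ≤ π` in the limit, and equality of
total masses turns this into `P π = π`. Averaging the same limit over an arbitrary stationary
distribution forces that distribution to be the limit, which is uniqueness. Countable additivity of
`excursionFreq` identifies the miss rate with the sum of `π` over the miss states. -/

lemma measure_eq_tsum_inter_fiber {α β : Type*} [MeasurableSpace α] [MeasurableSpace β]
    [Countable β] [MeasurableSingletonClass β] (μ : Measure α) {E : Set α} (hE : MeasurableSet E)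
    {f : α → β} (hf : Measurable f) : μ E = ∑' b, μ (E ∩ f ⁻¹' {b}) := by
  rw [← measure_iUnion (fun b c hbc => ?_) fun b => hE.inter (hf (measurableSet_singleton b)),
    ← Set.inter_iUnion, ← Set.preimage_iUnion, Set.iUnion_of_singleton, Set.preimage_univ,
    Set.inter_univ]
  exact ((Set.disjoint_singleton.2 hbc).preimage f).mono Set.inter_subset_right
    Set.inter_subset_right

/-! ### Trajectory space and prefix sets -/

section Trajectories

variable {S : Type*}

/-- The trajectories that agree with `a` up to time `n`. -/
def prefixSet (a : ℕ → S) (n : ℕ) : Set (ℕ → S) := {x | ∀ i ≤ n, x i = a i}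

/-- The trajectory seen from time `n` on. -/
def shift (n : ℕ) (x : ℕ → S) : ℕ → S := fun j => x (j + n)

lemma prefixSet_eq_preimage (a : ℕ → S) (n : ℕ) :
    prefixSet a n = Preorder.frestrictLe (π := fun _ => S) n ⁻¹' {Preorder.frestrictLe n a} := by
  ext x
  simp [prefixSet, funext_iff]

lemma prefixSet_succ (a : ℕ → S) (n : ℕ) :
    prefixSet a (n + 1) = prefixSet a n ∩ {x | x (n + 1) = a (n + 1)} := by
  ext x
  simp only [prefixSet, Set.mem_ofPred_eq, Set.mem_inter_iff]
  refine ⟨fun h => ⟨fun i hi => h i (by omega), h _ le_rfl⟩, fun h i hi => ?_⟩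
  rcases Nat.lt_or_ge n i with h1 | h1
  · obtain rfl : i = n + 1 := by omega
    exact h.2
  · exact h.1 i h1

lemma shift_shift (m n : ℕ) (x : ℕ → S) : shift m (shift n x) = shift (m + n) x := by
  funext j
  simp [shift, Nat.add_assoc]

variable [MeasurableSpace S]

lemma measurable_shift (n : ℕ) : Measurable (shift n : (ℕ → S) → ℕ → S) :=
  measurable_pi_lambda _ fun _ => measurable_pi_apply _

variable [DiscreteMeasurableSpace S]

lemma measurableSet_prefixSet (a : ℕ → S) (n : ℕ) : MeasurableSet (prefixSet a n) := by
  have : prefixSet a n = ⋂ i, ⋂ (_ : i ≤ n), (fun x : ℕ → S => x i) ⁻¹' {a i} := by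
    ext x; simp [prefixSet]
  rw [this]
  exact .iInter fun i => .iInter fun _ => measurable_pi_apply i (.of_discrete)

/-- A finite measure on trajectories is determined by the masses of the prefix sets. -/
lemma measure_ext_of_prefixSet [Countable S] {μ ν : Measure (ℕ → S)} [IsFiniteMeasure μ]
    [IsFiniteMeasure ν] (h : ∀ a n, μ (prefixSet a n) = ν (prefixSet a n)) : μ = ν := by
  -- A point `s₀` is needed below to extend finite paths to infinite ones; its choice is immaterial.
  rcases isEmpty_or_nonempty S with hS | ⟨⟨s₀⟩⟩
  · exact Measure.eq_zero_of_isEmpty μ |>.trans (Measure.eq_zero_of_isEmpty ν).symm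
  have hfam : IsProjectiveMeasureFamily (α := fun _ : ℕ => S) (fun I => ν.map I.restrict) := by
    intro I J hJI
    rw [Measure.map_map (Finset.measurable_restrict₂ hJI) (Finset.measurable_restrict I)]
    rfl
  have hν : IsProjectiveLimit ν (α := fun _ : ℕ => S) (fun I => ν.map I.restrict) := fun _ => rfl
  -- Finite projective limits are unique, and on `ℕ` it suffices to compare the marginals on initial
  -- segments, which are discrete.
  have hμ : IsProjectiveLimit μ (α := fun _ : ℕ => S) (fun I => ν.map I.restrict) := by
    rw [isProjectiveLimit_nat_iff' hfam μ 0]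
    intro n _
    change μ.map (Preorder.frestrictLe n) = ν.map (Preorder.frestrictLe n)
    refine Measure.ext_of_singleton fun p => ?_
    let a : ℕ → S := fun i => if hi : i ≤ n then p ⟨i, Finset.mem_Iic.2 hi⟩ else s₀
    have hp : Preorder.frestrictLe n a = p := by
      funext ⟨i, hi⟩
      simp [a, Finset.mem_Iic.1 hi]
    rw [Measure.map_apply (by fun_prop) (measurableSet_singleton p),
      Measure.map_apply (by fun_prop) (measurableSet_singleton p), ← hp,
      ← prefixSet_eq_preimage, h]
  exact hμ.unique hν

end Trajectories

/-! ### Path probabilities and the Markov property at fixed times -/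

namespace StochasticMatrix

variable {S : Type*} (P : StochasticMatrix S)

/-- The probability of following `a` for `n` steps. -/
noncomputable def pathWeight (a : ℕ → S) (n : ℕ) : ℝ≥0∞ :=
  ∏ i ∈ Finset.range n, ENNReal.ofReal (P.entry (a (i + 1)) (a i))

lemma pathWeight_congr {a b : ℕ → S} {n : ℕ} (h : ∀ i ≤ n, a i = b i) :
    P.pathWeight a n = P.pathWeight b n := by
  refine Finset.prod_congr rfl fun i hi => ?_
  have := Finset.mem_range.1 hi
  rw [h i (by omega), h (i + 1) (by omega)]

lemma pathWeight_add (a : ℕ → S) (m n : ℕ) :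
    P.pathWeight a (n + m) = P.pathWeight a n * P.pathWeight (shift n a) m := by
  simp only [pathWeight, Finset.prod_range_add]
  congr 1
  refine Finset.prod_congr rfl fun i _ => ?_
  simp only [shift]
  rw [show n + i + 1 = i + 1 + n by omega, Nat.add_comm n i]

variable [MeasurableSpace S] [DiscreteMeasurableSpace S]

instance (s : S) : IsProbabilityMeasure (P.lawFrom s) := by
  unfold lawFrom
  infer_instance

lemma stepKernel_singleton (s r : S) :
    P.stepKernel s {r} = ENNReal.ofReal (P.entry r s) := by
  change (P.col s).toMeasure {r} = _
  rw [PMF.toMeasure_apply_singleton _ _ (.of_discrete)]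
  rfl

variable [Countable S]

-- The marginal up to time `n + 1` is the composition-product of the marginal up to `n` with the
-- step kernel, so each step contributes one matrix entry. This translates the Ionescu-Tulcea
-- construction into elementary path weights.
open Classical in
lemma lawFrom_prefixSet (s : S) (a : ℕ → S) (n : ℕ) :
    P.lawFrom s (prefixSet a n) = (if a 0 = s then 1 else 0) * P.pathWeight a n := by
  induction n with
  | zero =>
    rw [prefixSet_eq_preimage, lawFrom,
      ← Measure.map_apply (by fun_prop) (measurableSet_singleton _),
      ProbabilityTheory.Kernel.traj_map_frestrictLe_apply,
      ProbabilityTheory.Kernel.partialTraj_self, ProbabilityTheory.Kernel.id_apply,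
      Measure.dirac_apply]
    simp only [pathWeight, Finset.range_zero, Finset.prod_empty, mul_one, Set.indicator_apply,
      Set.mem_singleton_iff, Pi.one_apply]
    refine if_congr ⟨fun h => ?_, fun h => ?_⟩ rfl rfl
    · exact (congrFun h ⟨0, by simp⟩).symm
    · funext ⟨i, hi⟩
      obtain rfl : i = 0 := by simpa using hi
      exact h.symm
  | succ n ih =>
    have hset : prefixSet a (n + 1) = (fun x : ℕ → S => (Preorder.frestrictLe n x, x (n + 1))) ⁻¹'
        ({Preorder.frestrictLe n a} ×ˢ {a (n + 1)}) := by
      rw [prefixSet_succ, prefixSet_eq_preimage]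
      rfl
    have hm : Measurable
        (fun x : ℕ → S => (Preorder.frestrictLe (π := fun _ => S) n x, x (n + 1))) := by
      fun_prop
    rw [hset, lawFrom, ← Measure.map_apply hm (.of_discrete),
      ← ProbabilityTheory.Kernel.partialTraj_compProd_eq_map_traj (Nat.zero_le n),
      Measure.compProd_apply_prod (.of_discrete) (.of_discrete), lintegral_singleton,
      ← ProbabilityTheory.Kernel.traj_map_frestrictLe_apply,
      Measure.map_apply (by fun_prop) (measurableSet_singleton _), ← prefixSet_eq_preimage]
    change P.stepKernel (a n) {a (n + 1)} * P.lawFrom s (prefixSet a n) = _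
    rw [ih, stepKernel_singleton, pathWeight, pathWeight, Finset.prod_range_succ]
    ring

lemma lawFrom_start (s : S) : P.lawFrom s {x | x 0 = s} = 1 := by
  have h := P.lawFrom_prefixSet s (fun _ => s) 0
  simpa [prefixSet, pathWeight] using h

/-- As functions of `C` both sides are finite measures, so it is enough to test prefix sets, where
the claim is multiplicativity of path weights under concatenation. -/
lemma lawFrom_prefixSet_inter_shift (s : S) (a : ℕ → S) (n : ℕ) {C : Set (ℕ → S)}
    (hC : MeasurableSet C) :
    P.lawFrom s (prefixSet a n ∩ shift n ⁻¹' C) =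
      P.lawFrom s (prefixSet a n) * P.lawFrom (a n) C := by
  classical
  have key : ((P.lawFrom s).restrict (prefixSet a n)).map (shift n) =
      (P.lawFrom s (prefixSet a n)) • P.lawFrom (a n) := by
    have : IsFiniteMeasure ((P.lawFrom s (prefixSet a n)) • P.lawFrom (a n)) :=
      ⟨by simp [Measure.smul_apply, measure_lt_top]⟩
    refine measure_ext_of_prefixSet fun b m => ?_
    rw [Measure.map_apply (measurable_shift n) (measurableSet_prefixSet b m),
      Measure.restrict_apply (measurable_shift n (measurableSet_prefixSet b m)),
      Measure.smul_apply, smul_eq_mul, P.lawFrom_prefixSet (a n)]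
    by_cases hb : b 0 = a n
    · let c : ℕ → S := fun i => if i ≤ n then a i else b (i - n)
      have hca : ∀ i ≤ n, c i = a i := fun i hi => by simp [c, hi]
      have hcb : ∀ i, shift n c i = b i := by
        intro i
        rcases Nat.eq_zero_or_pos i with rfl | hi
        · simp [shift, c, hb]
        · have : ¬ (i + n ≤ n) := by omega
          simp [shift, c, this]
      have hset : shift n ⁻¹' prefixSet b m ∩ prefixSet a n = prefixSet c (n + m) := by
        ext x
        simp only [prefixSet, Set.mem_inter_iff, Set.mem_preimage, Set.mem_ofPred_eq]
        constructor
        · rintro ⟨h1, h2⟩ i hi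
          rcases Nat.lt_or_ge n i with hn | hn
          · have h3 := h1 (i - n) (by omega)
            rw [← hcb] at h3
            simpa [shift, Nat.sub_add_cancel hn.le] using h3
          · rw [h2 i hn, hca i hn]
        · intro h
          refine ⟨fun i hi => ?_, fun i hi => ?_⟩
          · rw [← hcb]
            exact h (i + n) (by omega)
          · rw [h i (by omega), hca i hi]
      rw [hset, P.lawFrom_prefixSet, P.lawFrom_prefixSet, P.pathWeight_add,
        P.pathWeight_congr hca, hca 0 (Nat.zero_le _), show shift n c = b from funext hcb,
        if_pos hb]
      ring
    · have hset : shift n ⁻¹' prefixSet b m ∩ prefixSet a n = ∅ := by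
        refine Set.eq_empty_iff_forall_notMem.2 fun x hx => hb ?_
        have h1 := hx.1 0 (Nat.zero_le _)
        have h2 := hx.2 n le_rfl
        simp only [shift, Nat.zero_add] at h1
        rw [← h1, h2]
      rw [hset, if_neg hb]
      simp
  have h := congrArg (fun ν => ν C) key
  simp only [Measure.smul_apply, smul_eq_mul] at h
  rw [Measure.map_apply (measurable_shift n) hC,
    Measure.restrict_apply (measurable_shift n hC), Set.inter_comm] at h
  exact h

/-- The Markov property at the fixed time `n`: on an event `D` that depends only on the states up to
time `n`, the last of which is `r`, the trajectory from time `n` on has the law `P.lawFrom r`. -/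
lemma lawFrom_inter_shift (s r : S) (n : ℕ) {D C : Set (ℕ → S)} (hD : MeasurableSet D)
    (hdep : ∀ x y : ℕ → S, (∀ i ≤ n, x i = y i) → x ∈ D → y ∈ D)
    (hr : ∀ x ∈ D, x n = r) (hC : MeasurableSet C) :
    P.lawFrom s (D ∩ shift n ⁻¹' C) = P.lawFrom s D * P.lawFrom r C := by
  have hsum := fun {E : Set (ℕ → S)} (hE : MeasurableSet E) =>
    measure_eq_tsum_inter_fiber (P.lawFrom s) hE
      (Preorder.measurable_frestrictLe (X := fun _ : ℕ => S) n)
  rw [hsum (hD.inter (measurable_shift n hC)), hsum hD, ← ENNReal.tsum_mul_right]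
  refine tsum_congr fun p => ?_
  rcases (D ∩ Preorder.frestrictLe n ⁻¹' {p}).eq_empty_or_nonempty with h | ⟨a, haD, hap⟩
  · rw [Set.inter_right_comm, h]
    simp
  · obtain rfl : Preorder.frestrictLe n a = p := hap
    -- Since `D` is decided by the states up to time `n`, it contains any prefix set that it meets.
    have hDa : D ∩ prefixSet a n = prefixSet a n :=
      Set.inter_eq_right.2 fun x hx => hdep a x (fun i hi => (hx i hi).symm) haD
    rw [Set.inter_right_comm, ← prefixSet_eq_preimage, hDa,
      P.lawFrom_prefixSet_inter_shift s a n hC, hr a haD]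

end StochasticMatrix

/-! ### The law of a given Markov chain -/

section Chain

variable {Ω : Type*} [MeasurableSpace Ω] {μ : Measure Ω} [IsProbabilityMeasure μ] {S : Type*}
  [MeasurableSpace S] [DiscreteMeasurableSpace S] {X : ℕ → Ω → S} {P : StochasticMatrix S}

lemma IsMarkovChain.measure_prefix (hX : IsMarkovChain μ X P) (a : ℕ → S) (n : ℕ) :
    μ {ω | ∀ i ≤ n, X i ω = a i} = μ {ω | X 0 ω = a 0} * P.pathWeight a n := by
  induction n with
  | zero => simp [StochasticMatrix.pathWeight]
  | succ n ih =>
    have hmeas : ∀ k s, MeasurableSet {ω | X k ω = s} := fun k s =>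
      hX.measurable k (MeasurableSet.of_discrete (s := {s}))
    have hpre : MeasurableSet {ω | ∀ i ≤ n, X i ω = a i} := by
      simp only [Set.ofPred_forall]
      exact .iInter fun i => .iInter fun _ => hmeas i _
    have hset : {ω | ∀ i ≤ n + 1, X i ω = a i} =
        {ω | ∀ i ≤ n, X i ω = a i} ∩ {ω | X (n + 1) ω = a (n + 1)} := by
      ext ω
      exact (Set.ext_iff.1 (prefixSet_succ a n) (fun i => X i ω))
    have hsucc : P.pathWeight a (n + 1) =
        P.pathWeight a n * ENNReal.ofReal (P.entry (a (n + 1)) (a n)) := by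
      simp [StochasticMatrix.pathWeight, Finset.prod_range_succ]
    rw [hset, hsucc, ← mul_assoc, ← ih]
    -- The chain axioms constrain only histories of positive probability; for null histories both
    -- sides vanish.
    by_cases h0 : μ {ω | ∀ i ≤ n, X i ω = a i} = 0
    · rw [h0, zero_mul]
      exact measure_mono_null Set.inter_subset_left h0
    · have h1 : μ {ω | X n ω = a n} ≠ 0 := fun h =>
        h0 (measure_mono_null (fun ω hω => hω n le_rfl) h)
      rw [← hX.transition n (a n) _ h1, ← hX.markov n a _ h0,
        mul_comm, ProbabilityTheory.cond_mul_eq_inter hpre]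

/-- The law of a Markov chain is the mixture of the laws `P.lawFrom s` over its initial
distribution. -/
lemma IsMarkovChain.map_eq_sum [Countable S] (hX : IsMarkovChain μ X P) :
    μ.map (fun ω n => X n ω) = Measure.sum fun s => μ {ω | X 0 ω = s} • P.lawFrom s := by
  classical
  have hm : Measurable (fun ω n => X n ω) := measurable_pi_lambda _ hX.measurable
  have htot : ∑' s, μ {ω | X 0 ω = s} = 1 := by
    have h := tsum_measure_preimage_singleton (μ := μ) (f := X 0) Set.countable_univ
      (fun s _ => hX.measurable 0 (MeasurableSet.of_discrete (s := {s})))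
    rw [tsum_univ (f := fun s => μ (X 0 ⁻¹' {s})), Set.preimage_univ, measure_univ] at h
    exact h
  have : IsFiniteMeasure (Measure.sum fun s => μ {ω | X 0 ω = s} • P.lawFrom s) :=
    ⟨by simp [Measure.sum_apply, htot]⟩
  have : IsFiniteMeasure (μ.map (fun ω n => X n ω)) := inferInstance
  refine measure_ext_of_prefixSet fun a n => ?_
  rw [Measure.map_apply hm (measurableSet_prefixSet a n),
    Measure.sum_apply _ (measurableSet_prefixSet a n)]
  simp only [Measure.smul_apply, smul_eq_mul, P.lawFrom_prefixSet]
  rw [tsum_eq_single (a 0) (fun s hs => by simp [hs.symm]), if_pos rfl, one_mul]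
  exact hX.measure_prefix a n

lemma IsMarkovChain.ae_of_forall_lawFrom [Countable S] (hX : IsMarkovChain μ X P)
    {p : (ℕ → S) → Prop} (hp : ∀ s, ∀ᵐ x ∂P.lawFrom s, p x) :
    ∀ᵐ ω ∂μ, p (fun n => X n ω) := by
  have hm : Measurable (fun ω n => X n ω) := measurable_pi_lambda _ hX.measurable
  refine ae_of_ae_map hm.aemeasurable ?_
  rw [hX.map_eq_sum, Measure.ae_sum_iff]
  intro s
  exact Measure.ae_smul_measure (hp s) _

end Chain

/-! ### Measurability at random indices, and limits of averages -/

lemma measurable_apply_of_countable {ι α β : Type*} [Countable ι] [MeasurableSpace ι]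
    [MeasurableSingletonClass ι]
    [MeasurableSpace α] [MeasurableSpace β] {t : α → ι} (ht : Measurable t) {f : ι → α → β}
    (hf : ∀ i, Measurable (f i)) : Measurable fun x => f (t x) x := by
  intro B hB
  have : (fun x => f (t x) x) ⁻¹' B = ⋃ i, t ⁻¹' {i} ∩ f i ⁻¹' B := by
    ext x; simp
  rw [this]
  exact .iUnion fun i => (ht (measurableSet_singleton i)).inter (hf i hB)

/-- If a monotone function `S` grows like `y * k` along times `τ k` that grow like `m * k`, then it
grows like `y / m * N`. -/
lemma tendsto_div_of_tendsto_along {S : ℕ → ℝ} (hS : Monotone S) {τ : ℕ → ℕ} {m y : ℝ}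
    (hm : 0 < m) (hτ : Tendsto (fun k : ℕ => (τ k : ℝ) / k) atTop (𝓝 m))
    (hy : Tendsto (fun k : ℕ => S (τ k) / k) atTop (𝓝 y)) :
    Tendsto (fun N : ℕ => S N / N) atTop (𝓝 (y / m)) := by
  have hpos : ∀ᶠ k : ℕ in atTop, (0 : ℝ) < k :=
    (eventually_gt_atTop 0).mono fun k hk => Nat.cast_pos.2 hk
  have htop : Tendsto (fun k => (τ k : ℝ)) atTop atTop := by
    refine (hτ.pos_mul_atTop hm tendsto_natCast_atTop_atTop).congr' ?_
    filter_upwards [hpos] with k hk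
    field_simp
  -- For monotone `S`, convergence along `τ` suffices if, for each `a > 1`, eventually `τ (k + 1) ≤
  -- a * τ k`. This holds because `(τ (k + 1) - a * τ k) / k` tends to `m - a * m < 0`.
  refine tendsto_div_of_monotone_of_exists_subseq_tendsto_div S _ hS fun a ha => ⟨τ, ?_, ?_, ?_⟩
  · have h1 : Tendsto (fun k : ℕ => (τ (k + 1) : ℝ) / k) atTop (𝓝 m) := by
      have h2 : Tendsto (fun k : ℕ => ((k + 1 : ℕ) : ℝ) / k) atTop (𝓝 1) := by
        have h3 : Tendsto (fun k : ℕ => (1 : ℝ) + 1 / k) atTop (𝓝 (1 + 0)) :=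
          tendsto_const_nhds.add tendsto_one_div_atTop_nhds_zero_nat
        rw [add_zero] at h3
        refine h3.congr' ?_
        filter_upwards [hpos] with k hk
        push_cast
        field_simp
      have h4 := (hτ.comp (tendsto_add_atTop_nat 1)).mul h2
      rw [mul_one] at h4
      refine h4.congr fun k => ?_
      have : ((k + 1 : ℕ) : ℝ) ≠ 0 := by positivity
      simp only [Function.comp_apply]
      field_simp
    have h5 : m < a * m := by nlinarith
    have h6 := h1.sub (hτ.const_mul a)
    filter_upwards [hpos, h6.eventually_lt_const (show m - a * m < 0 by linarith)] with k hk hlt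
    have h7 : ((τ (k + 1) : ℝ) - a * τ k) / k < 0 := by
      rw [sub_div, mul_div_assoc]; exact hlt
    have := (div_lt_iff₀ hk).1 h7
    linarith
  · exact tendsto_natCast_atTop_iff.1 htop
  · refine (hy.div hτ hm.ne').congr' ?_
    filter_upwards [hpos] with k hk
    simp only [Pi.div_apply]
    field_simp

/-- The first `n` terms contribute `O(1/N)`, and the normalisations differ by the factor `(N + n) /
N`, which tends to `1`. -/
lemma tendsto_average_shift {u : ℕ → ℝ} {l : ℝ}
    (h : Tendsto (fun N : ℕ => (1 / (N : ℝ)) * ∑ j ∈ Finset.range N, u j) atTop (𝓝 l)) (n : ℕ) :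
    Tendsto (fun N : ℕ => (1 / (N : ℝ)) * ∑ j ∈ Finset.range N, u (j + n)) atTop (𝓝 l) := by
  have h1 := h.comp (tendsto_add_atTop_nat n)
  have h0 := tendsto_one_div_atTop_nhds_zero_nat (𝕜 := ℝ)
  have h2 : Tendsto (fun N : ℕ => 1 + n * (1 / (N : ℝ))) atTop (𝓝 (1 + n * 0)) :=
    tendsto_const_nhds.add (h0.const_mul _)
  have h3 := (h2.mul h1).sub (h0.mul_const (∑ j ∈ Finset.range n, u j))
  simp only [mul_zero, add_zero, one_mul, zero_mul, sub_zero] at h3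
  refine h3.congr' ?_
  filter_upwards [eventually_gt_atTop 0] with N hN
  have hN' : (N : ℝ) ≠ 0 := by positivity
  have hN'' : (N : ℝ) + n ≠ 0 := by positivity
  have hsplit : ∑ j ∈ Finset.range (N + n), u j =
      ∑ j ∈ Finset.range n, u j + ∑ j ∈ Finset.range N, u (j + n) := by
    rw [Nat.add_comm N n, Finset.sum_range_add]
    simp [Nat.add_comm]
  simp only [Function.comp_apply, hsplit]
  push_cast
  field_simp
  ring

/-! ### Excursions from a state, pathwise -/

section Excursions

variable {S : Type*}

/-- The trajectory `x` visits `A` with asymptotic frequency `l`. -/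
def HasFrequency (A : Set S) (l : ℝ) (x : ℕ → S) : Prop :=
  Tendsto (fun N : ℕ => (1 / (N : ℝ)) * ∑ j ∈ Finset.range N, A.indicator (1 : S → ℝ) (x j)) atTop
    (𝓝 l)

lemma HasFrequency.shift {A : Set S} {l : ℝ} {x : ℕ → S} (h : HasFrequency A l x) (n : ℕ) :
    HasFrequency A l (shift n x) :=
  tendsto_average_shift h n

/-- The first return time to `s` at a time `n ≥ 1`, and `0` if there is none. -/
noncomputable def firstReturn (s : S) (x : ℕ → S) : ℕ := sInf {n | 1 ≤ n ∧ x n = s}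

/-- The trajectory seen from its first return to `s` on. -/
noncomputable def afterReturn (s : S) (x : ℕ → S) : ℕ → S := shift (firstReturn s x) x

/-- The number of visits to `A` before the first return to `s`. -/
noncomputable def excursionVisits (s : S) (A : Set S) (x : ℕ → S) : ℝ :=
  ∑ j ∈ Finset.range (firstReturn s x), A.indicator 1 (x j)

lemma firstReturn_eq_iff {s : S} {x : ℕ → S} {n : ℕ} (hn : 1 ≤ n) :
    firstReturn s x = n ↔ x n = s ∧ ∀ k < n, 1 ≤ k → x k ≠ s := by
  constructor
  · rintro rfl
    have hne : {n | 1 ≤ n ∧ x n = s}.Nonempty := Nat.nonempty_of_pos_sInf hn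
    exact ⟨(Nat.sInf_mem hne).2, fun k hk h1 hs => Nat.notMem_of_lt_sInf hk ⟨h1, hs⟩⟩
  · rintro ⟨hs, hlt⟩
    have hmem : n ∈ {n | 1 ≤ n ∧ x n = s} := ⟨hn, hs⟩
    refine le_antisymm (Nat.sInf_le hmem) (not_lt.1 fun h => ?_)
    have := Nat.sInf_mem ⟨n, hmem⟩
    exact hlt _ h this.1 this.2

/-- The stopping-time property. The value `0` must be excluded: it encodes the absence of a return,
which no finite prefix can reveal. -/
lemma firstReturn_congr {s : S} {x y : ℕ → S} (h0 : firstReturn s x ≠ 0)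
    (h : ∀ i ≤ firstReturn s x, x i = y i) : firstReturn s y = firstReturn s x := by
  have hx := (firstReturn_eq_iff (Nat.one_le_iff_ne_zero.2 h0)).1 (rfl : firstReturn s x = _)
  refine (firstReturn_eq_iff (Nat.one_le_iff_ne_zero.2 h0)).2 ⟨?_, fun k hk h1 => ?_⟩
  · rw [← h _ le_rfl]; exact hx.1
  · rw [← h _ hk.le]; exact hx.2 k hk h1

lemma excursionVisits_congr {s : S} (A : Set S) {x y : ℕ → S} (h0 : firstReturn s x ≠ 0)
    (h : ∀ i ≤ firstReturn s x, x i = y i) : excursionVisits s A y = excursionVisits s A x := by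
  rw [excursionVisits, excursionVisits, firstReturn_congr h0 h]
  exact Finset.sum_congr rfl fun j hj => by rw [h j (Finset.mem_range.1 hj).le]

lemma excursionVisits_nonneg (s : S) (A : Set S) (x : ℕ → S) : 0 ≤ excursionVisits s A x :=
  Finset.sum_nonneg fun _ _ => Set.indicator_nonneg (fun _ _ => zero_le_one) _

lemma excursionVisits_le (s : S) (A : Set S) (x : ℕ → S) :
    excursionVisits s A x ≤ firstReturn s x := by
  have h : excursionVisits s A x ≤ ∑ j ∈ Finset.range (firstReturn s x), (1 : ℝ) :=
    Finset.sum_le_sum fun _ _ => Set.indicator_le_self' (fun _ _ => zero_le_one) _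
  simpa using h

lemma excursionVisits_univ (s : S) (x : ℕ → S) :
    excursionVisits s Set.univ x = firstReturn s x := by
  simp [excursionVisits]

/-- Each time before the return counts for exactly one state, so this is a finite sum of point
masses. It is the pathwise source of countable additivity of `excursionFreq`. -/
lemma hasSum_excursionVisits (s : S) (A : Set S) (x : ℕ → S) :
    HasSum (fun r : A => excursionVisits s {(r : S)} x) (excursionVisits s A x) := by
  classical
  refine hasSum_sum fun j _ => ?_
  have h1 : ∀ r : S, ({r} : Set S).indicator (1 : S → ℝ) (x j) = if r = x j then 1 else 0 := by
    intro r
    simp [Set.indicator_apply, eq_comm]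
  by_cases h : x j ∈ A
  · rw [Set.indicator_of_mem h]
    convert hasSum_ite_eq (⟨x j, h⟩ : A) (1 : ℝ) using 2 with r
    · rw [h1]
      simp [Subtype.ext_iff]
    · rfl
  · rw [Set.indicator_of_notMem h]
    convert hasSum_zero using 2 with r
    rw [h1, if_neg]
    rintro hr
    exact h (hr ▸ r.2)

/-- The time of the `k`-th return to `s`. -/
noncomputable def returnTime (s : S) (x : ℕ → S) (k : ℕ) : ℕ :=
  ∑ i ∈ Finset.range k, firstReturn s ((afterReturn s)^[i] x)

lemma iterate_afterReturn (s : S) (x : ℕ → S) (k : ℕ) :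
    (afterReturn s)^[k] x = shift (returnTime s x k) x := by
  induction k with
  | zero => rfl
  | succ k ih =>
    rw [Function.iterate_succ_apply', returnTime, Finset.sum_range_succ, ← returnTime,
      afterReturn, ih, shift_shift, Nat.add_comm]

/-- Consecutive excursions tile the times before the `k`-th return. -/
lemma sum_excursionVisits (s : S) (A : Set S) (x : ℕ → S) (k : ℕ) :
    ∑ i ∈ Finset.range k, excursionVisits s A ((afterReturn s)^[i] x) =
      ∑ j ∈ Finset.range (returnTime s x k), A.indicator (1 : S → ℝ) (x j) := by
  induction k with
  | zero => rfl
  | succ k ih =>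
    rw [Finset.sum_range_succ, ih, returnTime, returnTime, Finset.sum_range_succ,
      Finset.sum_range_add, ← returnTime, excursionVisits]
    congr 1
    refine Finset.sum_congr rfl fun j _ => ?_
    rw [iterate_afterReturn, shift, Nat.add_comm]

/-- `firstPassage` numbers states from `1`, so it exceeds a genuine return time by one; without a
return it is `∞` against the default `0`. The inequality holds in both cases and carries
integrability over. -/
lemma natCast_firstReturn_le (s : S) (x : ℕ → S) : (firstReturn s x : ℝ≥0∞) ≤ firstPassage s x :=
  le_iInf₂ fun n hn => by
    exact_mod_cast (Nat.sInf_le (s := {n | 1 ≤ n ∧ x n = s}) hn).trans n.le_succ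

lemma firstPassage_eq_top {s : S} {x : ℕ → S} (h : firstReturn s x = 0) :
    firstPassage s x = ∞ := by
  refine iInf₂_eq_top.2 fun n hn => ?_
  rcases Nat.sInf_eq_zero.1 h with h0 | h0
  · exact absurd h0.1 (by norm_num)
  · exact absurd hn (Set.eq_empty_iff_forall_notMem.1 h0 n)

variable [MeasurableSpace S] [DiscreteMeasurableSpace S]

lemma measurableSet_apply_eq (n : ℕ) (s : S) : MeasurableSet {x : ℕ → S | x n = s} :=
  (measurable_pi_apply (X := fun _ : ℕ => S) n) (MeasurableSet.of_discrete (s := {s}))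

lemma measurable_firstReturn (s : S) : Measurable (firstReturn s) := by
  have hpos : ∀ n, 1 ≤ n → MeasurableSet (firstReturn s ⁻¹' {n}) := by
    intro n hn
    have : firstReturn s ⁻¹' {n} =
        {x | x n = s} ∩ ⋂ k, ⋂ (_ : k < n), ⋂ (_ : 1 ≤ k), {x | x k = s}ᶜ := by
      ext x
      simp only [Set.mem_preimage, Set.mem_singleton_iff, firstReturn_eq_iff hn]
      simp
    rw [this]
    exact (measurableSet_apply_eq n s).inter (.iInter fun k => .iInter fun _ => .iInter fun _ =>
      (measurableSet_apply_eq k s).compl)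
  refine measurable_to_countable' fun n => ?_
  rcases Nat.eq_zero_or_pos n with rfl | hn
  · have : firstReturn s ⁻¹' {0} = (⋃ n, ⋃ (_ : 1 ≤ n), firstReturn s ⁻¹' {n})ᶜ := by
      ext x
      simp only [Set.mem_preimage, Set.mem_singleton_iff, Set.mem_compl_iff, Set.mem_iUnion,
        exists_prop, exists_eq_right', Nat.one_le_iff_ne_zero, not_not]
    rw [this]
    exact (MeasurableSet.iUnion fun n => MeasurableSet.iUnion fun hn => hpos n hn).compl
  · exact hpos n hn

lemma measurable_afterReturn (s : S) : Measurable (afterReturn s) :=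
  measurable_apply_of_countable (measurable_firstReturn s) measurable_shift

lemma measurable_indicator_apply (A : Set S) (j : ℕ) :
    Measurable fun x : ℕ → S => A.indicator (1 : S → ℝ) (x j) :=
  (Measurable.of_discrete (f := A.indicator (1 : S → ℝ))).comp (measurable_pi_apply j)

lemma measurableSet_hasFrequency (A : Set S) (l : ℝ) : MeasurableSet {x | HasFrequency A l x} :=
  measurableSet_tendsto _ fun _ =>
    (Finset.measurable_sum _ fun j _ => measurable_indicator_apply A j).const_mul _

lemma measurable_excursionVisits (s : S) (A : Set S) : Measurable (excursionVisits s A) :=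
  measurable_apply_of_countable (measurable_firstReturn s)
    (f := fun n x => ∑ j ∈ Finset.range n, A.indicator (1 : S → ℝ) (x j)) fun _ =>
    Finset.measurable_sum _ fun j _ => measurable_indicator_apply A j

end Excursions

/-! ### Independence of excursions and the strong law -/

namespace StochasticMatrix

variable {S : Type*} [MeasurableSpace S] [DiscreteMeasurableSpace S] {P : StochasticMatrix S}

/-- Without a return the passage time is `∞`; a finite mean makes that event null. -/
lemma IsPositiveRecurrent.firstReturn_ne_zero (hrec : P.IsPositiveRecurrent) (s : S) :
    ∀ᵐ x ∂P.lawFrom s, firstReturn s x ≠ 0 := by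
  have hmeas := measurable_firstReturn s (measurableSet_singleton 0)
  have hle : ∞ * P.lawFrom s (firstReturn s ⁻¹' {0}) ≤ ∫⁻ x, firstPassage s x ∂P.lawFrom s := by
    rw [← lintegral_indicator_const hmeas]
    refine lintegral_mono fun x => ?_
    by_cases hx : firstReturn s x = 0
    · rw [firstPassage_eq_top hx]; exact le_top
    · rw [Set.indicator_of_notMem (by simpa using hx)]; exact zero_le
  have h0 : P.lawFrom s (firstReturn s ⁻¹' {0}) = 0 := by
    by_contra h
    rw [ENNReal.top_mul h] at hle
    exact absurd (hrec s) (not_lt.2 hle)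
  rw [ae_iff]
  convert h0 using 2
  ext x
  simp

lemma IsPositiveRecurrent.integrable_firstReturn (hrec : P.IsPositiveRecurrent) (s : S) :
    Integrable (fun x => (firstReturn s x : ℝ)) (P.lawFrom s) := by
  refine ⟨(measurable_from_top.comp (measurable_firstReturn s)).aestronglyMeasurable, ?_⟩
  refine lt_of_le_of_lt (lintegral_mono fun x => ?_) (hrec s)
  refine le_trans (le_of_eq ?_) (natCast_firstReturn_le s x)
  simp

lemma IsPositiveRecurrent.integrable_excursionVisits (hrec : P.IsPositiveRecurrent) (s : S)
    (A : Set S) : Integrable (excursionVisits s A) (P.lawFrom s) := by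
  refine (hrec.integrable_firstReturn s).mono'
    (measurable_excursionVisits s A).aestronglyMeasurable (ae_of_all _ fun x => ?_)
  rw [Real.norm_of_nonneg (excursionVisits_nonneg s A x)]
  exact excursionVisits_le s A x

lemma IsPositiveRecurrent.integral_firstReturn_pos (hrec : P.IsPositiveRecurrent) (s : S) :
    0 < ∫ x, (firstReturn s x : ℝ) ∂P.lawFrom s := by
  have h : ∫ _, (1 : ℝ) ∂P.lawFrom s ≤ ∫ x, (firstReturn s x : ℝ) ∂P.lawFrom s := by
    refine integral_mono_ae (integrable_const _) (hrec.integrable_firstReturn s) ?_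
    filter_upwards [hrec.firstReturn_ne_zero s] with x hx
    exact_mod_cast Nat.one_le_iff_ne_zero.2 hx
  rw [integral_const, probReal_univ, one_smul] at h
  linarith

/-- The mean number of visits to `A` in an excursion from `s`, relative to its mean length. -/
noncomputable def excursionFreq (P : StochasticMatrix S) (s : S) (A : Set S) : ℝ :=
  (∫ x, excursionVisits s A x ∂P.lawFrom s) / ∫ x, (firstReturn s x : ℝ) ∂P.lawFrom s

lemma excursionFreq_nonneg (P : StochasticMatrix S) (s : S) (A : Set S) :
    0 ≤ P.excursionFreq s A :=
  div_nonneg (integral_nonneg fun x => excursionVisits_nonneg s A x)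
    (integral_nonneg fun _ => Nat.cast_nonneg _)

lemma IsPositiveRecurrent.excursionFreq_univ (hrec : P.IsPositiveRecurrent) (s : S) :
    P.excursionFreq s Set.univ = 1 := by
  simp only [excursionFreq, excursionVisits_univ]
  exact div_self (hrec.integral_firstReturn_pos s).ne'

variable [Countable S]

/-- The excursion up to the first return to `s` is independent of the trajectory after it, which is
distributed as the whole trajectory. -/
lemma IsPositiveRecurrent.lawFrom_inter_afterReturn (hrec : P.IsPositiveRecurrent) (s : S)
    {B C : Set (ℕ → S)} (hB : MeasurableSet B)
    (hdep : ∀ x y : ℕ → S, firstReturn s x ≠ 0 → (∀ i ≤ firstReturn s x, x i = y i) → x ∈ B → y ∈ B)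
    (hC : MeasurableSet C) :
    P.lawFrom s (B ∩ afterReturn s ⁻¹' C) = P.lawFrom s B * P.lawFrom s C := by
  rw [measure_eq_tsum_inter_fiber _ (hB.inter (measurable_afterReturn s hC))
    (measurable_firstReturn s), measure_eq_tsum_inter_fiber _ hB (measurable_firstReturn s),
    ← ENNReal.tsum_mul_right]
  refine tsum_congr fun n => ?_
  -- The fibre over `0` is the null event of no return. On a fibre over `n ≥ 1`, `afterReturn s` is
  -- `shift n` and the state at time `n` is `s`, so the fixed-time Markov property applies.
  by_cases hn : n = 0
  · subst hn
    have h0 : P.lawFrom s (firstReturn s ⁻¹' {0}) = 0 := by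
      have := hrec.firstReturn_ne_zero s
      rw [ae_iff] at this
      convert this using 2
      ext x
      simp
    rw [measure_mono_null Set.inter_subset_right h0, measure_mono_null Set.inter_subset_right h0,
      zero_mul]
  · have hset : B ∩ afterReturn s ⁻¹' C ∩ firstReturn s ⁻¹' {n} =
        (B ∩ firstReturn s ⁻¹' {n}) ∩ shift n ⁻¹' C := by
      rw [Set.inter_right_comm]
      ext x
      refine and_congr_right fun hx => ?_
      have : firstReturn s x = n := hx.2
      simp only [Set.mem_preimage, afterReturn, this]
    rw [hset]
    refine P.lawFrom_inter_shift s s n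
      (hB.inter (measurable_firstReturn s (measurableSet_singleton n))) ?_ ?_ hC
    · rintro x y hxy ⟨hxB, rfl⟩
      exact ⟨hdep x y hn hxy hxB, firstReturn_congr hn hxy⟩
    · rintro x ⟨-, rfl⟩
      exact ((firstReturn_eq_iff (Nat.one_le_iff_ne_zero.2 hn)).1 rfl).1

lemma IsPositiveRecurrent.measurePreserving_afterReturn (hrec : P.IsPositiveRecurrent) (s : S) :
    MeasurePreserving (afterReturn s) (P.lawFrom s) (P.lawFrom s) := by
  refine ⟨measurable_afterReturn s, Measure.ext fun C hC => ?_⟩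
  have h := hrec.lawFrom_inter_afterReturn s .univ (fun _ _ _ _ h => h) hC
  rw [Measure.map_apply (measurable_afterReturn s) hC]
  simpa using h

/-- The strong law of large numbers for functionals of the successive excursions from `s`. -/
lemma IsPositiveRecurrent.strong_law_excursions (hrec : P.IsPositiveRecurrent) (s : S)
    {Z : (ℕ → S) → ℝ} (hZ : Measurable Z) (hint : Integrable Z (P.lawFrom s))
    (hdep : ∀ x y : ℕ → S, firstReturn s x ≠ 0 → (∀ i ≤ firstReturn s x, x i = y i) → Z y = Z x) :
    ∀ᵐ x ∂P.lawFrom s, Tendsto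
      (fun k : ℕ => (∑ i ∈ Finset.range k, Z ((afterReturn s)^[i] x)) / k) atTop
      (𝓝 (∫ x, Z x ∂P.lawFrom s)) := by
  have hmp := hrec.measurePreserving_afterReturn s
  have hmeas : ∀ i, Measurable fun x => Z ((afterReturn s)^[i] x) := fun i =>
    hZ.comp (hmp.iterate i).measurable
  -- Pairwise independence is enough for the strong law used here. Since `(afterReturn s)^[i]`
  -- preserves the measure, it reduces to independence of the first excursion from the path after
  -- it.
  have hindep : ∀ i m : ℕ, ProbabilityTheory.IndepFun (fun x => Z ((afterReturn s)^[i] x))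
      (fun x => Z ((afterReturn s)^[m + 1 + i] x)) (P.lawFrom s) := by
    intro i m
    rw [ProbabilityTheory.indepFun_iff_measure_inter_preimage_eq_mul]
    intro B B' hB hB'
    have hC : MeasurableSet ((fun x => Z ((afterReturn s)^[m] x)) ⁻¹' B') := hmeas m hB'
    have h1 : (fun x => Z ((afterReturn s)^[m + 1 + i] x)) ⁻¹' B' = (afterReturn s)^[i] ⁻¹'
        (afterReturn s ⁻¹' ((fun x => Z ((afterReturn s)^[m] x)) ⁻¹' B')) := by
      ext x
      simp only [Set.mem_preimage, Function.iterate_add_apply, Function.iterate_one]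
    have h2 : (fun x => Z ((afterReturn s)^[i] x)) ⁻¹' B = (afterReturn s)^[i] ⁻¹' (Z ⁻¹' B) := rfl
    rw [h1, h2, ← Set.preimage_inter,
      (hmp.iterate i).measure_preimage
        ((hZ hB).inter (measurable_afterReturn s hC)).nullMeasurableSet,
      (hmp.iterate i).measure_preimage (hZ hB).nullMeasurableSet,
      (hmp.iterate i).measure_preimage (measurable_afterReturn s hC).nullMeasurableSet,
      hmp.measure_preimage hC.nullMeasurableSet]
    refine hrec.lawFrom_inter_afterReturn s (hZ hB) (fun x y h0 hxy hx => ?_) hC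
    rw [Set.mem_preimage, hdep x y h0 hxy]
    exact hx
  refine ProbabilityTheory.strong_law_ae_real (fun i x => Z ((afterReturn s)^[i] x)) hint ?_ ?_
  · intro i j hij
    rcases lt_or_gt_of_ne hij with h | h
    · obtain ⟨m, rfl⟩ := Nat.exists_eq_add_of_lt h
      have := hindep i m
      rwa [show m + 1 + i = i + m + 1 by omega] at this
    · obtain ⟨m, rfl⟩ := Nat.exists_eq_add_of_lt h
      have := hindep j m
      rw [show m + 1 + j = j + m + 1 by omega] at this
      exact this.symm
  · intro i
    exact ⟨(hmeas i).aemeasurable, (hmeas 0).aemeasurable, by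
      rw [show (fun x => Z ((afterReturn s)^[i] x)) = Z ∘ (afterReturn s)^[i] from rfl,
        ← Measure.map_map hZ (hmp.iterate i).measurable, (hmp.iterate i).map_eq]
      rfl⟩

/-- The pathwise decomposition is integrated termwise; its sum, the visits to `A`, is integrable
because it is at most the excursion length. -/
lemma IsPositiveRecurrent.hasSum_excursionFreq (hrec : P.IsPositiveRecurrent) (s : S)
    (A : Set S) : HasSum (fun r : A => P.excursionFreq s {(r : S)}) (P.excursionFreq s A) := by
  refine HasSum.div_const ?_ _
  refine hasSum_integral_of_dominated_convergence (fun r x => excursionVisits s {(r : S)} x)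
    (fun r => (measurable_excursionVisits s _).aestronglyMeasurable)
    (fun r => ae_of_all _ fun x => (Real.norm_of_nonneg (excursionVisits_nonneg s _ x)).le)
    (ae_of_all _ fun x => (hasSum_excursionVisits s A x).summable) ?_
    (ae_of_all _ fun x => hasSum_excursionVisits s A x)
  simp only [(hasSum_excursionVisits s A _).tsum_eq]
  exact hrec.integrable_excursionVisits s A

/-- The ergodic theorem for the chain started at `s`. -/
lemma IsPositiveRecurrent.tendsto_average_self (hrec : P.IsPositiveRecurrent) (s : S)
    (A : Set S) : ∀ᵐ x ∂P.lawFrom s, HasFrequency A (P.excursionFreq s A) x := by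
  filter_upwards [hrec.strong_law_excursions s
      (measurable_from_top.comp (measurable_firstReturn s)) (hrec.integrable_firstReturn s)
      (fun x y h0 hxy => congrArg (Nat.cast : ℕ → ℝ) (firstReturn_congr h0 hxy)),
    hrec.strong_law_excursions s (measurable_excursionVisits s A)
      (hrec.integrable_excursionVisits s A)
      (fun x y h0 hxy => excursionVisits_congr A h0 hxy)] with x h1 h2
  have hmono : Monotone fun N : ℕ => ∑ j ∈ Finset.range N, A.indicator (1 : S → ℝ) (x j) :=
    monotone_nat_of_le_succ fun N => by
      rw [Finset.sum_range_succ]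
      exact le_add_of_nonneg_right (Set.indicator_nonneg (fun _ _ => zero_le_one) _)
  -- Along return times, both the elapsed time and the visit count grow linearly in `k`;
  -- monotonicity of the count fills in the times between.
  refine (tendsto_div_of_tendsto_along hmono (τ := returnTime s x)
    (hrec.integral_firstReturn_pos s) (h1.congr fun k => ?_) (h2.congr fun k => ?_)).congr
    fun N => ?_
  · simp [returnTime]
  · rw [sum_excursionVisits]
  · ring

end StochasticMatrix

/-! ### Arbitrary initial states and the stationary distribution -/

namespace StochasticMatrix

lemma tsum_ofReal_entry {S : Type*} (P : StochasticMatrix S) (s : S) :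
    ∑' r, ENNReal.ofReal (P.entry r s) = 1 := by
  rw [← ENNReal.ofReal_tsum_of_nonneg (fun r => P.nonneg r s) (P.hasSum_col s).summable,
    (P.hasSum_col s).tsum_eq, ENNReal.ofReal_one]

variable {S : Type*} [Countable S] [MeasurableSpace S] [DiscreteMeasurableSpace S]

section

variable (P : StochasticMatrix S)

lemma lawFrom_apply_one (q r : S) :
    P.lawFrom q {x | x 1 = r} = ENNReal.ofReal (P.entry r q) := by
  have h := P.lawFrom_prefixSet q (fun i => if i = 0 then q else r) 1
  rw [prefixSet_succ] at h
  have h0 : prefixSet (fun i => if i = 0 then q else r) 0 = {x : ℕ → S | x 0 = q} := by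
    ext x; simp [prefixSet]
  have h1 : P.lawFrom q {x : ℕ → S | x 0 = q}ᶜ = 0 :=
    (prob_compl_eq_zero_iff (measurableSet_apply_eq 0 q)).2 (P.lawFrom_start q)
  rw [h0, Nat.zero_add, Set.inter_comm, measure_inter_conull h1] at h
  simpa [pathWeight] using h

/-- The forward equation for the laws of the states. -/
lemma lawFrom_apply_succ (s r : S) (n : ℕ) : P.lawFrom s {x | x (n + 1) = r} =
    ∑' q, ENNReal.ofReal (P.entry r q) * P.lawFrom s {x | x n = q} := by
  rw [measure_eq_tsum_inter_fiber _ (measurableSet_apply_eq (n + 1) r) (measurable_pi_apply n)]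
  refine tsum_congr fun q => ?_
  have h := P.lawFrom_inter_shift s q n (measurableSet_apply_eq n q)
    (fun x y hxy hx => (hxy n le_rfl).symm.trans hx) (fun _ hx => hx) (measurableSet_apply_eq 1 r)
  rw [P.lawFrom_apply_one, mul_comm] at h
  rw [← h, Set.inter_comm]
  refine congrArg _ (congrArg₂ _ rfl ?_)
  ext x
  simp [shift, Nat.add_comm]

end

variable {P : StochasticMatrix S}

lemma IsIrreducible.exists_lawFrom_ne_zero (hirr : P.IsIrreducible) (s r : S) :
    ∃ n, P.lawFrom s {x | x n = r} ≠ 0 := by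
  have hstep : ∀ {b c : S} {n : ℕ}, P.lawFrom s {x | x n = b} ≠ 0 → 0 < P.entry c b →
      P.lawFrom s {x | x (n + 1) = c} ≠ 0 := by
    intro b c n hb hc
    rw [P.lawFrom_apply_succ, ENNReal.summable.tsum_ne_zero_iff]
    exact ⟨b, mul_ne_zero (by simpa using hc) hb⟩
  have h := hirr s r
  induction h with
  | single h => exact ⟨1, hstep (n := 0) (by rw [P.lawFrom_start]; exact one_ne_zero) h⟩
  | tail _ h ih =>
    obtain ⟨n, hn⟩ := ih
    exact ⟨n + 1, hstep hn h⟩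

/-- The ergodic theorem for the chain with an arbitrary initial state. -/
lemma IsPositiveRecurrent.tendsto_average (hrec : P.IsPositiveRecurrent)
    (hirr : P.IsIrreducible) (s₀ s : S) (A : Set S) :
    ∀ᵐ x ∂P.lawFrom s, HasFrequency A (P.excursionFreq s₀ A) x := by
  obtain ⟨n, hn⟩ := hirr.exists_lawFrom_ne_zero s₀ s
  have h0 : P.lawFrom s₀ {x | HasFrequency A (P.excursionFreq s₀ A) x}ᶜ = 0 :=
    mem_ae_iff.1 (hrec.tendsto_average_self s₀ A)
  have h1 := P.lawFrom_inter_shift s₀ s n (measurableSet_apply_eq n s)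
    (fun x y hxy hx => (hxy n le_rfl).symm.trans hx) (fun _ hx => hx)
    (measurableSet_hasFrequency A (P.excursionFreq s₀ A)).compl
  -- A path whose tail lacks the frequency lacks it too. So the null failure probability from `s₀`
  -- bounds the product of the chance of being at `s` at time `n`, which is nonzero, and the failure
  -- probability from `s`.
  rw [measure_mono_null (fun x hx hxE => hx.2 (HasFrequency.shift hxE n)) h0] at h1
  exact mem_ae_iff.2 ((mul_eq_zero.1 h1.symm).resolve_left hn)

/-- The expectation of the almost sure limit, by bounded convergence. That the limit does not depend
on `s` is what yields uniqueness later. -/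
lemma IsPositiveRecurrent.tendsto_average_prob (hrec : P.IsPositiveRecurrent)
    (hirr : P.IsIrreducible) (s₀ s r : S) : Tendsto
      (fun N : ℕ => (1 / (N : ℝ)) * ∑ j ∈ Finset.range N, (P.lawFrom s).real {x | x j = r}) atTop
      (𝓝 (P.excursionFreq s₀ {r})) := by
  have hint : ∀ j, Integrable (fun x : ℕ → S => ({r} : Set S).indicator (1 : S → ℝ) (x j))
      (P.lawFrom s) := fun j =>
    .of_bound (measurable_indicator_apply _ j).aestronglyMeasurable 1 (ae_of_all _ fun x => by
      by_cases h : x j ∈ ({r} : Set S) <;> simp [h])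
  have h := tendsto_integral_of_dominated_convergence (μ := P.lawFrom s) (fun _ => (1 : ℝ))
    (F := fun (N : ℕ) x => (1 / (N : ℝ)) *
      ∑ j ∈ Finset.range N, ({r} : Set S).indicator (1 : S → ℝ) (x j))
    (f := fun _ => P.excursionFreq s₀ {r})
    (fun N => ((integrable_finsetSum _ fun j _ => hint j).const_mul _).aestronglyMeasurable)
    (integrable_const _) (fun N => ae_of_all _ fun x => ?_)
    (hrec.tendsto_average hirr s₀ s {r})
  · rw [integral_const, probReal_univ, one_smul] at h
    refine h.congr fun N => ?_
    rw [integral_const_mul, integral_finsetSum _ fun j _ => hint j]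
    congr 1
    refine Finset.sum_congr rfl fun j _ => ?_
    exact integral_indicator_one (measurableSet_apply_eq j r)
  · have h1 : ∑ j ∈ Finset.range N, ({r} : Set S).indicator (1 : S → ℝ) (x j) ≤
        ∑ j ∈ Finset.range N, (1 : ℝ) :=
      Finset.sum_le_sum fun _ _ => Set.indicator_le_self' (fun _ _ => zero_le_one) _
    have h0 : 0 ≤ ∑ j ∈ Finset.range N, ({r} : Set S).indicator (1 : S → ℝ) (x j) :=
      Finset.sum_nonneg fun _ _ => Set.indicator_nonneg (fun _ _ => zero_le_one) _
    simp only [Finset.sum_const, Finset.card_range, nsmul_eq_mul, mul_one] at h1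
    rw [Real.norm_of_nonneg (by positivity), one_div, inv_mul_eq_div]
    exact div_le_one_of_le₀ h1 (Nat.cast_nonneg _)

lemma IsPositiveRecurrent.hasSum_excursionFreq_singleton (hrec : P.IsPositiveRecurrent) (s : S) :
    HasSum (fun r => P.excursionFreq s {r}) 1 := by
  have h := hrec.hasSum_excursionFreq s Set.univ
  rw [hrec.excursionFreq_univ] at h
  exact (Equiv.Set.univ S).hasSum_iff.1 h

/-- The time-averaged forward equation, truncated to `F` so that the limit passes through the sum;
the truncation costs equality. -/
lemma IsPositiveRecurrent.sum_entry_mul_excursionFreq_le (hrec : P.IsPositiveRecurrent)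
    (hirr : P.IsIrreducible) (s r : S) (F : Finset S) :
    ∑ q ∈ F, P.entry r q * P.excursionFreq s {q} ≤ P.excursionFreq s {r} := by
  have hlim := tendsto_average_shift (hrec.tendsto_average_prob hirr s s r) 1
  have hlim' : Tendsto (fun N : ℕ => ∑ q ∈ F, P.entry r q *
      ((1 / (N : ℝ)) * ∑ j ∈ Finset.range N, (P.lawFrom s).real {x | x j = q})) atTop
      (𝓝 (∑ q ∈ F, P.entry r q * P.excursionFreq s {q})) :=
    tendsto_finsetSum _ fun q _ => (hrec.tendsto_average_prob hirr s s q).const_mul _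
  refine le_of_tendsto_of_tendsto' hlim' hlim fun N => ?_
  have hstep : ∀ j, ∑ q ∈ F, P.entry r q * (P.lawFrom s).real {x | x j = q} ≤
      (P.lawFrom s).real {x | x (j + 1) = r} := by
    intro j
    have h := ENNReal.sum_le_tsum (f := fun q => ENNReal.ofReal (P.entry r q) *
      P.lawFrom s {x | x j = q}) F
    rw [← P.lawFrom_apply_succ] at h
    have h' := ENNReal.toReal_mono (measure_ne_top _ _) h
    rw [ENNReal.toReal_sum fun q _ => ENNReal.mul_ne_top ENNReal.ofReal_ne_top
      (measure_ne_top _ _)] at h'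
    simpa [Measure.real, ENNReal.toReal_mul, ENNReal.toReal_ofReal (P.nonneg r _)] using h'
  calc ∑ q ∈ F, P.entry r q *
      ((1 / (N : ℝ)) * ∑ j ∈ Finset.range N, (P.lawFrom s).real {x | x j = q})
      = (1 / (N : ℝ)) * ∑ j ∈ Finset.range N,
          ∑ q ∈ F, P.entry r q * (P.lawFrom s).real {x | x j = q} := by
        rw [Finset.sum_comm, Finset.mul_sum]
        refine Finset.sum_congr rfl fun q _ => ?_
        rw [← Finset.mul_sum]
        ring
    _ ≤ _ := mul_le_mul_of_nonneg_left (Finset.sum_le_sum fun j _ => hstep j) (by positivity)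

/-- The truncated bounds give `P π ≤ π`. As the columns of `P` sum to `1`, both sides have total
mass `1`, so no coordinate can be strictly smaller. -/
lemma IsPositiveRecurrent.isStationary_excursionFreq (hrec : P.IsPositiveRecurrent)
    (hirr : P.IsIrreducible) (s : S) : P.IsStationary fun r => P.excursionFreq s {r} := by
  set π : S → ℝ := fun r => P.excursionFreq s {r} with hπ
  have hπ0 : ∀ r, 0 ≤ π r := fun r => P.excursionFreq_nonneg s {r}
  have hsum : HasSum π 1 := hrec.hasSum_excursionFreq_singleton s
  have hterm : ∀ r q, 0 ≤ P.entry r q * π q := fun r q => mul_nonneg (P.nonneg r q) (hπ0 q)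
  have hle : ∀ r (F : Finset S), ∑ q ∈ F, P.entry r q * π q ≤ π r :=
    hrec.sum_entry_mul_excursionFreq_le hirr s
  have hsummable : ∀ r, Summable fun q => P.entry r q * π q := fun r =>
    summable_of_sum_le (hterm r) (hle r)
  have hmass : ∑' q, ENNReal.ofReal (π q) = 1 := by
    rw [← ENNReal.ofReal_tsum_of_nonneg hπ0 hsum.summable, hsum.tsum_eq, ENNReal.ofReal_one]
  have hflow : ∑' r, ∑' q, ENNReal.ofReal (P.entry r q * π q) = 1 := by
    rw [ENNReal.tsum_comm, ← hmass]
    refine tsum_congr fun q => ?_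
    simp only [ENNReal.ofReal_mul (P.nonneg _ q), ENNReal.tsum_mul_right, P.tsum_ofReal_entry,
      one_mul]
  have hle' : ∀ r, ∑' q, ENNReal.ofReal (P.entry r q * π q) ≤ ENNReal.ofReal (π r) := by
    intro r
    rw [← ENNReal.ofReal_tsum_of_nonneg (hterm r) (hsummable r)]
    exact ENNReal.ofReal_le_ofReal ((hsummable r).tsum_le_of_sum_le (hle r))
  refine ⟨hπ0, hsum, fun r => ?_⟩
  have heq : ∑' q, ENNReal.ofReal (P.entry r q * π q) = ENNReal.ofReal (π r) := by
    refine (hle' r).eq_of_not_lt fun hlt => ?_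
    have := ENNReal.tsum_lt_tsum (by rw [hflow]; exact ENNReal.one_ne_top) hle' hlt
    rw [hflow, hmass] at this
    exact lt_irrefl _ this
  rw [← ENNReal.ofReal_tsum_of_nonneg (hterm r) (hsummable r),
    ENNReal.ofReal_eq_ofReal_iff (tsum_nonneg (hterm r)) (hπ0 r)] at heq
  rw [← heq]
  exact (hsummable r).hasSum

/-- Started from `π`, the chain has law `π` at all times. Working in `ℝ≥0∞` makes the exchange of
sums free. -/
lemma IsStationary.tsum_mul_lawFrom {π : S → ℝ} (hπ : P.IsStationary π) (n : ℕ) (r : S) :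
    ∑' s, ENNReal.ofReal (π s) * P.lawFrom s {x | x n = r} = ENNReal.ofReal (π r) := by
  induction n generalizing r with
  | zero =>
    rw [tsum_eq_single r, P.lawFrom_start, mul_one]
    intro s hs
    have : P.lawFrom s {x | x 0 = r} = 0 := by
      refine measure_mono_null (t := {x | x 0 = s}ᶜ) (fun x hx hx' => hs ?_) ?_
      · exact (show x 0 = s from hx').symm.trans hx
      · rw [prob_compl_eq_zero_iff (measurableSet_apply_eq 0 s)]
        exact P.lawFrom_start s
    rw [this, mul_zero]
  | succ n ih =>
    simp only [P.lawFrom_apply_succ, ← ENNReal.tsum_mul_left]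
    rw [ENNReal.tsum_comm, ← (hπ.invariant r).tsum_eq, ENNReal.ofReal_tsum_of_nonneg
      (fun q => mul_nonneg (P.nonneg r q) (hπ.nonneg q)) (hπ.invariant r).summable]
    refine tsum_congr fun q => ?_
    rw [ENNReal.ofReal_mul (P.nonneg r q), ← ih q, ← ENNReal.tsum_mul_left]
    exact tsum_congr fun s => mul_left_comm _ _ _

lemma IsStationary.hasSum_mul_lawFrom {π : S → ℝ} (hπ : P.IsStationary π) (n : ℕ) (r : S) :
    HasSum (fun s => π s * (P.lawFrom s).real {x | x n = r}) (π r) := by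
  have h := hπ.tsum_mul_lawFrom n r
  have h' := ENNReal.hasSum_toReal (by rw [h]; exact ENNReal.ofReal_ne_top)
  rw [← ENNReal.tsum_toReal_eq fun s => ENNReal.mul_ne_top ENNReal.ofReal_ne_top
    (measure_ne_top _ _), h, ENNReal.toReal_ofReal (hπ.nonneg r)] at h'
  simpa [Measure.real, ENNReal.toReal_mul, ENNReal.toReal_ofReal (hπ.nonneg _)] using h'

/-- For every `N ≥ 1`, `π r` is the `π`-mixture of the time-averaged probabilities of `r`. These
converge to a limit independent of the initial state, with `π` itself as dominating series. -/
lemma IsStationary.eq_excursionFreq {π : S → ℝ} (hπ : P.IsStationary π)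
    (hrec : P.IsPositiveRecurrent) (hirr : P.IsIrreducible) (s₀ r : S) :
    π r = P.excursionFreq s₀ {r} := by
  have hlim := tendsto_tsum_of_dominated_convergence (𝓕 := atTop) (bound := π)
    (f := fun (N : ℕ) s => π s *
      ((1 / (N : ℝ)) * ∑ j ∈ Finset.range N, (P.lawFrom s).real {x | x j = r}))
    (g := fun s => π s * P.excursionFreq s₀ {r}) hπ.hasSum_one.summable
    (fun s => (hrec.tendsto_average_prob hirr s₀ s r).const_mul _)
    (Eventually.of_forall fun N s => ?_)
  · rw [(hπ.hasSum_one.mul_right _).tsum_eq, one_mul] at hlim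
    refine tendsto_nhds_unique (tendsto_const_nhds.congr' ?_) hlim
    filter_upwards [eventually_gt_atTop 0] with N hN
    have h := (hasSum_sum fun j (_ : j ∈ Finset.range N) =>
      hπ.hasSum_mul_lawFrom j r).mul_left (1 / (N : ℝ))
    have hval : (1 / (N : ℝ)) * ∑ j ∈ Finset.range N, π r = π r := by
      have : (N : ℝ) ≠ 0 := by positivity
      simp only [Finset.sum_const, Finset.card_range, nsmul_eq_mul]
      field_simp
    rw [hval] at h
    rw [← h.tsum_eq]
    refine tsum_congr fun s => ?_
    rw [← Finset.mul_sum]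
    ring
  · have h1 : ∑ j ∈ Finset.range N, (P.lawFrom s).real {x | x j = r} ≤
        ∑ j ∈ Finset.range N, (1 : ℝ) := Finset.sum_le_sum fun _ _ => measureReal_le_one
    have h0 : 0 ≤ ∑ j ∈ Finset.range N, (P.lawFrom s).real {x | x j = r} :=
      Finset.sum_nonneg fun _ _ => measureReal_nonneg
    simp only [Finset.sum_const, Finset.card_range, nsmul_eq_mul, mul_one] at h1
    have := hπ.nonneg s
    rw [Real.norm_of_nonneg (by positivity), one_div, inv_mul_eq_div]
    exact mul_le_of_le_one_right this (div_le_one_of_le₀ h1 (Nat.cast_nonneg _))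

end StochasticMatrix

end DeadlineMiss

theorem theorem2 {Ω : Type*} [MeasurableSpace Ω] (μ : Measure Ω) [IsProbabilityMeasure μ]
    {S : Type*} [Countable S] [MeasurableSpace S] [DiscreteMeasurableSpace S]
    (P : DeadlineMiss.StochasticMatrix S) (X : ℕ → Ω → S)
    (hX : DeadlineMiss.IsMarkovChain μ X P)
    (hirr : P.IsIrreducible) (hrec : P.IsPositiveRecurrent)
    (SDM : Set S) (missed : ℕ → Set Ω)
    (hmissed : ∀ (j : ℕ) (ω : Ω), ω ∈ missed j ↔ X j ω ∈ SDM) :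
    ∃ π : S → ℝ, P.IsStationary π ∧ (∀ π' : S → ℝ, P.IsStationary π' → π' = π) ∧
      (∀ᵐ ω ∂μ, Tendsto (fun N : ℕ => DeadlineMiss.DMRUpTo missed N ω) atTop
        (𝓝 (∑' s : SDM, π s))) ∧
      (∀ d : ℝ, DeadlineMiss.IsDeadlineMissRate μ missed d ↔ d = ∑' s : SDM, π s) := by
  -- Serves only to supply a reference state `X 0 ω₀` for the excursions.
  obtain ⟨ω₀⟩ : Nonempty Ω := μ.nonempty_of_neZero
  have hlim : ∀ᵐ ω ∂μ, Tendsto (fun N : ℕ => DeadlineMiss.DMRUpTo missed N ω) atTop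
      (𝓝 (∑' s : SDM, P.excursionFreq (X 0 ω₀) {(s : S)})) := by
    rw [(hrec.hasSum_excursionFreq (X 0 ω₀) SDM).tsum_eq]
    have hfreq := hX.ae_of_forall_lawFrom
      (p := DeadlineMiss.HasFrequency SDM (P.excursionFreq (X 0 ω₀) SDM))
      fun s => hrec.tendsto_average hirr (X 0 ω₀) s SDM
    filter_upwards [hfreq] with ω hω
    refine Tendsto.congr (fun N => ?_) hω
    unfold DeadlineMiss.DMRUpTo
    refine congrArg _ (Finset.sum_congr rfl fun j _ => ?_)
    by_cases h : X j ω ∈ SDM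
    · simp [DeadlineMiss.DM, h, (hmissed j ω).2 h]
    · simp [DeadlineMiss.DM, h, mt (hmissed j ω).1 h]
  refine ⟨fun r => P.excursionFreq (X 0 ω₀) {r}, hrec.isStationary_excursionFreq hirr _,
    fun π' hπ' => funext fun r => hπ'.eq_excursionFreq hrec hirr _ r, hlim,
    fun d => ⟨fun hd => ?_, ?_⟩⟩
  · obtain ⟨ω, h1, h2⟩ := (hd.and hlim).exists
    exact tendsto_nhds_unique h1 h2
  · rintro rfl
    exact hlim
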